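/- Given a finite digraph $D$, its competition graph $C(D)$ is the simple graph with the same vertex set as $D$ in which two distinct vertices $u,v$ are adjacent if and only if they have a common out-neighbor in $D$. A $k$-partite tournament is an orientation (each edge receives exactly one of its two directions) of a complete $k$-partite graph, all of whose $k$ partite sets are nonempty. Theorem. Let $k \ge 3$ be an integer. The complete graph $K_n$ on $n$ vertices is the competition graph of some $k$-partite tournament if and only if \[ \begin{cases} n \ge 13 & \text{if } k = 3;\\ n \ge 10 & \text{if } k = 4;\\ n \ge 9 & \text{if } k = 5;\\ n \ge 9 & \text{if } k = 6;\\ n \ge k & \text{if } k \ge 7. \end{cases} \] -/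

import Mathlib

/-- The competition graph `C(D)` of a digraph `D`: the simple graph on the vertex set of `D` in which
two distinct vertices are adjacent iff they have a common out-neighbor in `D`. -/
def competitionGraph {V : Type*} (D : Digraph V) : SimpleGraph V where
  Adj u v := u ≠ v ∧ ∃ w, D.Adj u w ∧ D.Adj v w
  symm := ⟨fun _ _ h => ⟨h.1.symm, h.2.imp fun _ hw => ⟨hw.2, hw.1⟩⟩⟩
  loopless := ⟨fun _ h => h.1 rfl⟩

/-- `D` is an orientation of the simple graph `G`: it has no loops and no directed 2-cycles
(asymmetry of `D.Adj` says both), and its underlying graph is `G`. -/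
def IsOrientation {V : Type*} (D : Digraph V) (G : SimpleGraph V) : Prop :=
  (∀ u v, D.Adj u v → ¬ D.Adj v u) ∧ D.toSimpleGraphInclusive = G

/-- `G` is a complete `k`-partite graph: its vertex set is split into `k` nonempty partite sets (the
fibers of `part`), and two vertices are adjacent iff they lie in different partite sets. -/
def IsCompletePartite {V : Type*} (k : ℕ) (G : SimpleGraph V) : Prop :=
  ∃ part : V → Fin k, Function.Surjective part ∧ ∀ u v, G.Adj u v ↔ part u ≠ part v

/-- A `k`-partite tournament is an orientation of a complete `k`-partite graph. -/
def IsPartiteTournament {V : Type*} (k : ℕ) (D : Digraph V) : Prop :=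
  ∃ G : SimpleGraph V, IsCompletePartite k G ∧ IsOrientation D G

/-! Cloning a vertex keeps a competition graph complete, so for each `k` it is enough to find the
least possible number of vertices: explicit digraphs realize the bounds for `k ≤ 6`, and the Paley
tournament on seven vertices, with dominating vertices added one at a time, realizes `n = k ≥ 7`.

For the lower bounds, every vertex has out-degree at least three, and the out-neighborhood of a
vertex of out-degree three is a directed triangle.

* For `k = 3`, each vertex has at least two out-neighbors in each of the two other partite sets.
  With twelve vertices this forces three partite sets of size four and exactly two out-neighbors
  each, and no pattern of intersections between these pairs of out-neighbors is consistent.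
* For `k = 4`, a vertex of out-degree three lies in a partite set of size at least four, so with
  nine vertices all such vertices lie in the same partite set, and there are too many arcs.
* For `k = 5` and `k = 6` with eight vertices, a vertex of out-degree three whose out-neighbors all
  have out-degree three would produce seven pairwise adjacent vertices. Hence every vertex of
  out-degree three dominates one of larger out-degree, and there are too many arcs again.
-/

open Finset

/-- `D` is an orientation of the complete multipartite graph whose partite sets are the fibers of
`p`, all of them nonempty, and any two distinct vertices of `D` have a common out-neighbor; in other
words, `D` is a multipartite tournament whose competition graph is complete. -/
structure IsCompetitive {V ι : Type*} (D : Digraph V) (p : V → ι) : Prop where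
  surjective : Function.Surjective p
  asymm : ∀ u v, D.Adj u v → ¬ D.Adj v u
  adj_or_adj_iff : ∀ u v, D.Adj u v ∨ D.Adj v u ↔ p u ≠ p v
  exists_common : ∀ u v, u ≠ v → ∃ w, D.Adj u w ∧ D.Adj v w

/-- The complete graph on `V` is the competition graph of a `k`-partite tournament, phrased through
`IsCompetitive`; see `exists_isPartiteTournament_iff_isRealizable`. -/
def IsRealizable (k : ℕ) (V : Type*) : Prop :=
  ∃ (D : Digraph V) (p : V → Fin k), IsCompetitive D p

theorem IsOrientation.adj_iff {V : Type*} {D : Digraph V} {G : SimpleGraph V}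
    (h : IsOrientation D G) (u v : V) : G.Adj u v ↔ D.Adj u v ∨ D.Adj v u := by
  rw [← h.2, Digraph.toSimpleGraphInclusive, SimpleGraph.fromRel_adj, and_iff_right_iff_imp]
  rintro huv rfl
  exact h.1 u u (or_self_iff.1 huv) (or_self_iff.1 huv)

theorem competitionGraph_eq_completeGraph_iff {V : Type*} {D : Digraph V} :
    competitionGraph D = SimpleGraph.completeGraph V ↔
      ∀ u v, u ≠ v → ∃ w, D.Adj u w ∧ D.Adj v w := by
  simp only [SimpleGraph.ext_iff, funext_iff, eq_iff_iff, competitionGraph,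
    SimpleGraph.completeGraph_eq_top, SimpleGraph.top_adj, and_iff_left_iff_imp]

theorem exists_isPartiteTournament_iff_isRealizable {V : Type*} {k : ℕ} :
    (∃ D : Digraph V, IsPartiteTournament k D ∧
      competitionGraph D = SimpleGraph.completeGraph V) ↔ IsRealizable k V := by
  refine exists_congr fun D => ⟨?_, ?_⟩
  · rintro ⟨⟨G, ⟨p, hp, hG⟩, hD⟩, hC⟩
    exact ⟨p, hp, hD.1, fun u v => by rw [← hD.adj_iff, hG],
      competitionGraph_eq_completeGraph_iff.1 hC⟩
  · rintro ⟨p, h⟩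
    have hD : IsOrientation D D.toSimpleGraphInclusive := ⟨h.asymm, rfl⟩
    exact ⟨⟨_, ⟨p, h.surjective, fun u v => by rw [hD.adj_iff, h.adj_or_adj_iff]⟩, hD⟩,
      competitionGraph_eq_completeGraph_iff.2 h.exists_common⟩

namespace IsCompetitive

variable {V ι : Type*} {D : Digraph V} {p : V → ι}

theorem part_ne (h : IsCompetitive D p) {u v : V} (huv : D.Adj u v) : p u ≠ p v :=
  (h.adj_or_adj_iff u v).1 (Or.inl huv)

theorem ne (h : IsCompetitive D p) {u v : V} (huv : D.Adj u v) : u ≠ v :=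
  ne_of_apply_ne p (h.part_ne huv)

theorem exists_adj [Nontrivial ι] (h : IsCompetitive D p) (u : V) : ∃ v, D.Adj u v := by
  obtain ⟨i, hi⟩ := exists_ne (p u)
  obtain ⟨v, rfl⟩ := h.surjective i
  obtain ⟨w, huw, -⟩ := h.exists_common u v (ne_of_apply_ne p hi.symm)
  exact ⟨w, huw⟩

theorem comap [Nontrivial ι] (h : IsCompetitive D p) {W : Type*} {f : W → V}
    (hf : Function.Surjective f) :
    IsCompetitive ⟨fun u v => D.Adj (f u) (f v)⟩ (p ∘ f) where
  surjective := h.surjective.comp hf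
  asymm _ _ := h.asymm _ _
  adj_or_adj_iff _ _ := h.adj_or_adj_iff _ _
  exists_common u v _ := by
    by_cases huv : f u = f v
    · obtain ⟨w, hw⟩ := h.exists_adj (f u)
      obtain ⟨w, rfl⟩ := hf w
      exact ⟨w, hw, show D.Adj (f v) (f w) from huv ▸ hw⟩
    · obtain ⟨w, hw⟩ := h.exists_common _ _ huv
      obtain ⟨w, rfl⟩ := hf w
      exact ⟨w, hw⟩

theorem comp_equiv {κ : Type*} (h : IsCompetitive D p) (e : ι ≃ κ) : IsCompetitive D (e ∘ p) where
  surjective := e.surjective.comp h.surjective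
  asymm := h.asymm
  adj_or_adj_iff u v := (h.adj_or_adj_iff u v).trans e.injective.ne_iff.symm
  exists_common := h.exists_common

end IsCompetitive

namespace IsRealizable

variable {V W : Type*} {k m : ℕ}

theorem of_embedding (hk : 2 ≤ k) (h : IsRealizable k V) (f : V ↪ W) : IsRealizable k W := by
  obtain ⟨D, p, h⟩ := h
  have : Nontrivial (Fin k) := Fin.nontrivial_iff_two_le.2 hk
  obtain ⟨v, -⟩ := h.surjective ⟨0, by lia⟩
  have : Nonempty V := ⟨v⟩
  exact ⟨_, _, h.comap (Function.invFun_surjective f.injective)⟩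

theorem of_le_card (hk : 2 ≤ k) (h : IsRealizable k (Fin m)) (hm : m ≤ ENat.card V) :
    IsRealizable k V := by
  obtain ⟨f, -⟩ := Fin.Embedding.exists_embedding_disjoint_range_of_add_le_ENat_card
    (s := (∅ : Set V)) (by simpa using hm)
  exact h.of_embedding hk f

theorem succ_le_card (hk : 2 ≤ k) (hm : ¬ IsRealizable k (Fin m)) (h : IsRealizable k V) :
    ((m + 1 : ℕ) : ℕ∞) ≤ ENat.card V := by
  cases finite_or_infinite V
  · have := Fintype.ofFinite V
    rw [ENat.card_eq_coe_fintype_card, Nat.cast_le]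
    by_contra! hV
    obtain ⟨f⟩ : Nonempty (V ↪ Fin m) :=
      Function.Embedding.nonempty_of_card_le (by simpa using Nat.lt_succ_iff.1 hV)
    exact hm (h.of_embedding hk f)
  · simp

theorem le_card (h : IsRealizable k V) : (k : ℕ∞) ≤ ENat.card V := by
  obtain ⟨D, p, h⟩ := h
  simpa using ENat.card_le_card_of_injective (Function.injective_surjInv h.surjective)

end IsRealizable

section Constructions

/-- The digraph obtained from `D` by adding the vertex `none`, which dominates all vertices
of `D`. -/
def cone {V : Type*} (D : Digraph V) : Digraph (Option V) where
  Adj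
    | some u, some v => D.Adj u v
    | none, some _ => True
    | _, none => False

theorem IsCompetitive.cone {V ι : Type*} [Nontrivial ι] {D : Digraph V} {p : V → ι}
    (h : IsCompetitive D p) : IsCompetitive (cone D) (Option.map p) where
  surjective
    | none => ⟨none, rfl⟩
    | some i => (h.surjective i).imp' some fun _ hv => congrArg some hv
  asymm
    | some u, some v => h.asymm u v
    | none, some _ => fun _ => id
    | some _, none | none, none => False.elim
  adj_or_adj_iff
    | some u, some v => by simpa [_root_.cone] using h.adj_or_adj_iff u v
    | none, some _ => by simp [_root_.cone]
    | some _, none => by simp [_root_.cone]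
    | none, none => by simp [_root_.cone]
  exists_common
    | some u, some v => fun huv =>
      (h.exists_common u v (ne_of_apply_ne some huv)).imp' some fun _ => id
    | none, some v => fun _ => (h.exists_adj v).imp' some fun _ hw => ⟨trivial, hw⟩
    | some u, none => fun _ => (h.exists_adj u).imp' some fun _ hw => ⟨hw, trivial⟩
    | none, none => fun huv => absurd rfl huv

theorem IsRealizable.succ {k m : ℕ} (hk : 2 ≤ k) (h : IsRealizable k (Fin m)) :
    IsRealizable (k + 1) (Fin (m + 1)) := by
  obtain ⟨D, p, h⟩ := h
  have : Nontrivial (Fin k) := Fin.nontrivial_iff_two_le.2 hk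
  have : Nontrivial (Fin (k + 1)) := Fin.nontrivial_iff_two_le.2 (by lia)
  exact ⟨_, _, (h.cone.comp_equiv (finSuccEquiv k).symm).comap (finSuccEquiv m).surjective⟩

/-- The digraph in which `u` dominates the vertices listed in `N u`. -/
def ofOutNeighborLists {n : ℕ} (N : Fin n → List (Fin n)) : Digraph (Fin n) where
  Adj u v := v ∈ N u

instance {n : ℕ} (N : Fin n → List (Fin n)) : DecidableRel (ofOutNeighborLists N).Adj :=
  fun u v => inferInstanceAs (Decidable (v ∈ N u))

theorem isRealizable_three_thirteen : IsRealizable 3 (Fin 13) :=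
  ⟨ofOutNeighborLists
    ![[7, 8, 10, 11], [5, 8, 9, 12], [5, 6, 10, 11], [6, 7, 9, 11], [6, 7, 10, 12],
      [0, 3, 4, 9, 10], [0, 1, 11, 12], [1, 2, 9, 10], [2, 3, 4, 11, 12],
      [0, 2, 4, 6, 8], [1, 3, 6, 8], [1, 4, 5, 7], [0, 2, 3, 5, 7]],
    ![0, 0, 0, 0, 0, 1, 1, 1, 1, 2, 2, 2, 2],
    by decide +kernel, by decide +kernel, by decide +kernel, by decide +kernel⟩

theorem isRealizable_four_ten : IsRealizable 4 (Fin 10) :=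
  ⟨ofOutNeighborLists
    ![[5, 6, 9], [4, 6, 8], [5, 7, 8], [4, 7, 9], [0, 2, 8, 9], [1, 3, 8, 9],
      [2, 3, 4, 5], [0, 1, 4, 5], [0, 3, 6, 7], [1, 2, 6, 7]],
    ![0, 0, 0, 0, 1, 1, 2, 2, 3, 3],
    by decide +kernel, by decide +kernel, by decide +kernel, by decide +kernel⟩

theorem isRealizable_five_nine : IsRealizable 5 (Fin 9) :=
  ⟨ofOutNeighborLists
    ![[2, 5, 6, 7], [3, 4, 6, 7], [1, 6, 8], [0, 7, 8], [0, 2, 3, 6], [1, 2, 3, 7],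
      [3, 5, 8], [2, 4, 8], [0, 1, 4, 5]],
    ![0, 0, 1, 1, 2, 2, 3, 3, 4],
    by decide +kernel, by decide +kernel, by decide +kernel, by decide +kernel⟩

theorem isRealizable_six_nine : IsRealizable 6 (Fin 9) :=
  ⟨ofOutNeighborLists
    ![[2, 3, 4, 5], [2, 5, 7, 8], [4, 6, 8], [1, 5, 6, 7, 8], [1, 3, 6, 7], [2, 7, 8],
      [0, 1, 5, 8], [0, 2, 6], [0, 4, 7]],
    ![0, 0, 1, 1, 2, 2, 3, 4, 5],
    by decide +kernel, by decide +kernel, by decide +kernel, by decide +kernel⟩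

-- The Paley tournament: `u` dominates `u + s` for the quadratic residues `s` modulo `7`.
theorem isRealizable_seven_seven : IsRealizable 7 (Fin 7) :=
  ⟨ofOutNeighborLists fun u => [u + 1, u + 2, u + 4], id,
    by decide +kernel, by decide +kernel, by decide +kernel, by decide +kernel⟩

theorem isRealizable_self {k : ℕ} (hk : 7 ≤ k) : IsRealizable k (Fin k) := by
  induction k, hk using Nat.le_induction with
  | base => exact isRealizable_seven_seven
  | succ k hk ih => exact ih.succ (by lia)

end Constructions

section Counting

variable {V ι : Type*}

open scoped Classical in
/-- The partite set with index `i`, as a finset. -/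
noncomputable def partiteSet [Fintype V] (p : V → ι) (i : ι) : Finset V := {v | p v = i}

open scoped Classical in
/-- The out-neighbors of `u` that lie in `S`. -/
noncomputable def outNeighbors (D : Digraph V) (S : Finset V) (u : V) : Finset V :=
  {v ∈ S | D.Adj u v}

open scoped Classical in
/-- The in-neighbors of `u` that lie in `S`. -/
noncomputable def inNeighbors (D : Digraph V) (S : Finset V) (u : V) : Finset V :=
  {v ∈ S | D.Adj v u}

/-- The out-degree of a vertex. -/
noncomputable def outdeg [Fintype V] (D : Digraph V) (u : V) : ℕ := #(outNeighbors D univ u)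

@[simp]
theorem mem_partiteSet [Fintype V] {p : V → ι} {i : ι} {v : V} :
    v ∈ partiteSet p i ↔ p v = i := by
  simp [partiteSet]

@[simp]
theorem mem_outNeighbors {D : Digraph V} {S : Finset V} {u v : V} :
    v ∈ outNeighbors D S u ↔ v ∈ S ∧ D.Adj u v := by
  simp [outNeighbors]

@[simp]
theorem mem_inNeighbors {D : Digraph V} {S : Finset V} {u v : V} :
    v ∈ inNeighbors D S u ↔ v ∈ S ∧ D.Adj v u := by
  simp [inNeighbors]

theorem outNeighbors_outNeighbors [DecidableEq V] (D : Digraph V) (S : Finset V) (u v : V) :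
    outNeighbors D (outNeighbors D S u) v = outNeighbors D S u ∩ outNeighbors D S v := by
  grind [mem_outNeighbors]

theorem sum_card_outNeighbors (D : Digraph V) (S T : Finset V) :
    ∑ u ∈ S, #(outNeighbors D T u) = ∑ v ∈ T, #(inNeighbors D S v) := by
  classical
  exact sum_card_bipartiteAbove_eq_sum_card_bipartiteBelow D.Adj

theorem sum_card_partiteSet [Fintype V] [Fintype ι] (p : V → ι) :
    ∑ i, #(partiteSet p i) = Fintype.card V := by
  classical
  exact (Finset.card_eq_sum_card_fiberwise fun _ _ => mem_coe.2 (mem_univ _)).symm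

theorem sum_card_partiteSet_comp [Fintype V] [Fintype ι] (p : V → ι) :
    ∑ u, #(partiteSet p (p u)) = ∑ i, #(partiteSet p i) ^ 2 := by
  classical
  rw [← Finset.sum_fiberwise univ p]
  refine sum_congr rfl fun i _ => ?_
  calc ∑ u with p u = i, #(partiteSet p (p u)) = ∑ _u ∈ partiteSet p i, #(partiteSet p i) :=
        sum_congr (by ext; simp) fun u hu => by rw [mem_partiteSet.1 hu]
    _ = #(partiteSet p i) ^ 2 := by rw [sum_const, smul_eq_mul, sq]

/-- Keeping one term of `∑ j, (#Vⱼ - 1) (#Vⱼ - 2)`, all of whose terms are nonnegative. -/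
theorem card_partiteSet_sub_one_mul_sub_two_le [Fintype V] [Fintype ι] (p : V → ι) (i : ι) :
    ((#(partiteSet p i) : ℤ) - 1) * (#(partiteSet p i) - 2) ≤
      ∑ j, (#(partiteSet p j) : ℤ) ^ 2 - 3 * Fintype.card V + 2 * Fintype.card ι := by
  have nonneg (s : ℕ) : 0 ≤ ((s : ℤ) - 1) * (s - 2) := by
    rcases s with _ | _ | s
    · simp
    · simp
    · push_cast
      nlinarith
  calc ((#(partiteSet p i) : ℤ) - 1) * (#(partiteSet p i) - 2)
      ≤ ∑ j, ((#(partiteSet p j) : ℤ) - 1) * (#(partiteSet p j) - 2) :=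
        single_le_sum (f := fun j => ((#(partiteSet p j) : ℤ) - 1) * (#(partiteSet p j) - 2))
          (fun j _ => nonneg _) (mem_univ i)
    _ = ∑ j, ((#(partiteSet p j) : ℤ) ^ 2 - 3 * #(partiteSet p j) + 2) :=
        sum_congr rfl fun j _ => by ring
    _ = _ := by
        rw [sum_add_distrib, sum_sub_distrib, ← mul_sum, ← sum_card_partiteSet p]
        simp [mul_comm]

namespace IsCompetitive

variable {D : Digraph V} {p : V → ι}

theorem card_partiteSet_pos [Fintype V] (h : IsCompetitive D p) (i : ι) :
    0 < #(partiteSet p i) := by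
  obtain ⟨v, hv⟩ := h.surjective i
  exact card_pos.2 ⟨v, mem_partiteSet.2 hv⟩

theorem card_outNeighbors_add_card_inNeighbors [Fintype V] [DecidableEq V]
    (h : IsCompetitive D p) (S : Finset V) (u : V) :
    #(outNeighbors D S u) + #(inNeighbors D S u) + #(S ∩ partiteSet p (p u)) = #S := by
  have asymm := h.asymm u
  have adj := h.adj_or_adj_iff u
  rw [← card_union_of_disjoint, ← card_union_of_disjoint]
  · congr 1
    grind [mem_outNeighbors, mem_inNeighbors, mem_partiteSet]
  · rw [Finset.disjoint_left]
    grind [mem_outNeighbors, mem_inNeighbors, mem_partiteSet]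
  · rw [Finset.disjoint_left]
    grind [mem_outNeighbors, mem_inNeighbors]

theorem two_mul_sum_outdeg_add [Fintype V] [Fintype ι] (h : IsCompetitive D p) :
    2 * ∑ u, outdeg D u + ∑ i, #(partiteSet p i) ^ 2 = Fintype.card V ^ 2 := by
  classical
  calc 2 * ∑ u, outdeg D u + ∑ i, #(partiteSet p i) ^ 2
      = ∑ u, (outdeg D u + #(inNeighbors D univ u) + #(univ ∩ partiteSet p (p u))) := by
        simp only [two_mul, sum_add_distrib, ← sum_card_outNeighbors, univ_inter,
          sum_card_partiteSet_comp, outdeg]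
    _ = ∑ _u : V, Fintype.card V :=
        sum_congr rfl fun _ _ => h.card_outNeighbors_add_card_inNeighbors univ _
    _ = Fintype.card V ^ 2 := by rw [sum_const, smul_eq_mul, card_univ, sq]

theorem exists_adj_path (h : IsCompetitive D p) {u x : V} (hx : D.Adj u x) :
    ∃ y z, D.Adj u y ∧ D.Adj u z ∧ D.Adj x y ∧ D.Adj y z := by
  obtain ⟨y, hy, hxy⟩ := h.exists_common u x (h.ne hx)
  obtain ⟨z, hz, hyz⟩ := h.exists_common u y (h.ne hy)
  exact ⟨y, z, hy, hz, hxy, hyz⟩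

theorem ne_of_adj_of_adj (h : IsCompetitive D p) {x y z : V} (hxy : D.Adj x y)
    (hyz : D.Adj y z) : x ≠ z := by
  rintro rfl
  exact h.asymm _ _ hxy hyz

theorem card_eq_three_of_adj_path [DecidableEq V] (h : IsCompetitive D p) {x y z : V}
    (hxy : D.Adj x y) (hyz : D.Adj y z) : #{x, y, z} = 3 :=
  card_eq_three.2 ⟨x, y, z, h.ne hxy, h.ne_of_adj_of_adj hxy hyz, h.ne hyz, rfl⟩

theorem three_le_outdeg [Fintype V] [Nontrivial ι] (h : IsCompetitive D p) (u : V) :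
    3 ≤ outdeg D u := by
  classical
  obtain ⟨x, hx⟩ := h.exists_adj u
  obtain ⟨y, z, hy, hz, hxy, hyz⟩ := h.exists_adj_path hx
  rw [← h.card_eq_three_of_adj_path hxy hyz]
  exact card_le_card (by grind [mem_outNeighbors])

theorem three_mul_card_add_le_sum_outdeg [Fintype V] [Nontrivial ι] (h : IsCompetitive D p) :
    3 * Fintype.card V + #{u | outdeg D u ≠ 3} ≤ ∑ u, outdeg D u := by
  rw [card_filter, ← card_univ, mul_comm, ← smul_eq_mul, ← sum_const, ← sum_add_distrib]
  refine sum_le_sum fun u _ => ?_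
  have := h.three_le_outdeg u
  split_ifs <;> lia

end IsCompetitive

end Counting

section OutTriangle

variable {V ι : Type*}

/-- The out-neighborhood of `u` consists of the three vertices of the directed triangle
`x → y → z → x`. -/
structure IsOutTriangle (D : Digraph V) (u x y z : V) : Prop where
  adj_iff : ∀ v, D.Adj u v ↔ v = x ∨ v = y ∨ v = z
  xy : D.Adj x y
  yz : D.Adj y z
  zx : D.Adj z x

namespace IsOutTriangle

variable {D : Digraph V} {u x y z : V}

theorem rotate (T : IsOutTriangle D u x y z) : IsOutTriangle D u y z x where
  adj_iff v := by rw [T.adj_iff, or_rotate]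
  xy := T.yz
  yz := T.zx
  zx := T.xy

theorem adj (T : IsOutTriangle D u x y z) : D.Adj u x :=
  (T.adj_iff x).2 (Or.inl rfl)

end IsOutTriangle

namespace IsCompetitive

variable {D : Digraph V} {p : V → ι} {u x y z : V}

theorem exists_isOutTriangle [Fintype V] (h : IsCompetitive D p) (hu : outdeg D u = 3)
    (hx : D.Adj u x) : ∃ y z, IsOutTriangle D u x y z := by
  classical
  obtain ⟨y, z, hy, hz, hxy, hyz⟩ := h.exists_adj_path hx
  have hN : {x, y, z} = outNeighbors D univ u :=
    eq_of_subset_of_card_le (by grind [mem_outNeighbors])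
      (hu.le.trans (h.card_eq_three_of_adj_path hxy hyz).ge)
  have adj_iff (v : V) : D.Adj u v ↔ v = x ∨ v = y ∨ v = z := by
    simpa using (Finset.ext_iff.1 hN v).symm
  obtain ⟨w, hw, hzw⟩ := h.exists_common u z (h.ne hz)
  obtain rfl | rfl | rfl := (adj_iff w).1 hw
  · exact ⟨y, z, adj_iff, hxy, hyz, hzw⟩
  · exact absurd hzw (h.asymm _ _ hyz)
  · exact absurd rfl (h.ne hzw)

theorem exists_isOutTriangle_of_outdeg_eq_three [Fintype V] [Nontrivial ι]
    (h : IsCompetitive D p) (hu : outdeg D u = 3) : ∃ x y z, IsOutTriangle D u x y z :=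
  (h.exists_adj u).imp fun _ hx => h.exists_isOutTriangle hu hx

theorem eq_of_isOutTriangle (h : IsCompetitive D p) (T : IsOutTriangle D u x y z) {v : V}
    (hu : D.Adj u v) (hx : D.Adj x v) : v = y := by
  obtain rfl | rfl | rfl := (T.adj_iff v).1 hu
  · exact absurd rfl (h.ne hx)
  · rfl
  · exact absurd hx (h.asymm _ _ T.zx)

/-- A common out-neighbor `a` of `y` and `z` differs from `u`, and the common out-neighbor of `a`
and `u` can only be `x`. -/
theorem exists_adj_of_isOutTriangle (h : IsCompetitive D p) (T : IsOutTriangle D u x y z) :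
    ∃ a, D.Adj a x ∧ D.Adj y a ∧ D.Adj z a := by
  obtain ⟨a, hya, hza⟩ := h.exists_common y z (h.ne T.yz)
  obtain ⟨w, huw, haw⟩ := h.exists_common u a (h.ne_of_adj_of_adj T.rotate.adj hya)
  obtain rfl | rfl | rfl := (T.adj_iff w).1 huw
  · exact ⟨a, haw, hya, hza⟩
  · exact absurd haw (h.asymm _ _ hya)
  · exact absurd haw (h.asymm _ _ hza)

end IsCompetitive

end OutTriangle

section FourPartite

namespace IsCompetitive

variable {V : Type*} {D : Digraph V} {p : V → Fin 4} {u x y z : V}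

theorem part_eq_of_isOutTriangle (h : IsCompetitive D p) (T : IsOutTriangle D u x y z) {a : V}
    (hax : D.Adj a x) (hya : D.Adj y a) (hza : D.Adj z a) : p a = p u := by
  have hux := h.part_ne T.adj
  have huy := h.part_ne T.rotate.adj
  have huz := h.part_ne T.rotate.rotate.adj
  have hxy := h.part_ne T.xy
  have hyz := h.part_ne T.yz
  have hzx := h.part_ne T.zx
  have hax := h.part_ne hax
  have hya := h.part_ne hya
  have hza := h.part_ne hza
  lia

/-- Besides `u`, its partite set contains a vertex completing each arc of the triangle. -/
theorem four_le_card_partiteSet [Fintype V] (h : IsCompetitive D p) (hu : outdeg D u = 3) :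
    4 ≤ #(partiteSet p (p u)) := by
  classical
  obtain ⟨x, y, z, T⟩ := h.exists_isOutTriangle_of_outdeg_eq_three hu
  obtain ⟨a, hax, hya, hza⟩ := h.exists_adj_of_isOutTriangle T
  obtain ⟨b, hby, hzb, hxb⟩ := h.exists_adj_of_isOutTriangle T.rotate
  obtain ⟨c, hcz, hxc, hyc⟩ := h.exists_adj_of_isOutTriangle T.rotate.rotate
  have hpa := h.part_eq_of_isOutTriangle T hax hya hza
  have hpb := h.part_eq_of_isOutTriangle T.rotate hby hzb hxb
  have hpc := h.part_eq_of_isOutTriangle T.rotate.rotate hcz hxc hyc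
  have hua : u ≠ a := h.ne_of_adj_of_adj T.rotate.adj hya
  have hub : u ≠ b := h.ne_of_adj_of_adj T.adj hxb
  have huc : u ≠ c := h.ne_of_adj_of_adj T.adj hxc
  have hab : a ≠ b := h.ne_of_adj_of_adj hax hxb
  have hac : a ≠ c := h.ne_of_adj_of_adj hax hxc
  have hbc : b ≠ c := h.ne_of_adj_of_adj hby hyc
  have hcard : #{u, a, b, c} = 4 := card_eq_four.2 ⟨u, a, b, c, hua, hub, huc, hab, hac, hbc, rfl⟩
  exact hcard.ge.trans (card_le_card (by grind [mem_partiteSet]))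

/-- Two partite sets of size at least four and two others need ten vertices. -/
theorem part_eq_of_outdeg_eq_three [Fintype V] (h : IsCompetitive D p)
    (hV : Fintype.card V ≤ 9) {u v : V} (hu : outdeg D u = 3) (hv : outdeg D v = 3) :
    p u = p v := by
  by_contra hne
  have hu := h.four_le_card_partiteSet hu
  have hv := h.four_le_card_partiteSet hv
  have hsum : ∑ i, (#(partiteSet p i) - 1) + 4 = Fintype.card V := by
    rw [← sum_card_partiteSet p, ← Finset.sum_congr rfl fun i _ =>
      Nat.sub_add_cancel (h.card_partiteSet_pos i), sum_add_distrib]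
    simp
  have hpair : ∑ i ∈ {p u, p v}, (#(partiteSet p i) - 1) ≤ ∑ i, (#(partiteSet p i) - 1) :=
    sum_le_sum_of_subset (subset_univ _)
  rw [sum_pair hne] at hpair
  lia

theorem card_ne_nine [Fintype V] (h : IsCompetitive D p) : Fintype.card V ≠ 9 := by
  intro hV
  obtain ⟨i, hi⟩ : ∃ i, ∀ u, outdeg D u = 3 → p u = i := by
    by_cases hex : ∃ u, outdeg D u = 3
    · obtain ⟨u, hu⟩ := hex
      exact ⟨p u, fun v hv => h.part_eq_of_outdeg_eq_three hV.le hv hu⟩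
    · exact ⟨0, fun u hu => absurd ⟨u, hu⟩ hex⟩
  have hle : #{u | outdeg D u = 3} ≤ #(partiteSet p i) :=
    card_le_card fun u hu => mem_partiteSet.2 (hi u (mem_filter.1 hu).2)
  have hcompl : #{u | outdeg D u = 3} + #{u | outdeg D u ≠ 3} = Fintype.card V :=
    card_filter_add_card_filter_not _
  have hdeg := h.three_mul_card_add_le_sum_outdeg
  have hsq := card_partiteSet_sub_one_mul_sub_two_le p i
  have harcs := h.two_mul_sum_outdeg_add
  rw [hV] at hcompl hdeg hsq harcs
  rw [Fintype.card_fin] at hsq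
  zify at *
  -- With `s = #(partiteSet p i)` these bounds combine to `(2 * s - 5) ^ 2 + 23 ≤ 0`.
  nlinarith [sq_nonneg (2 * (#(partiteSet p i) : ℤ) - 5)]

end IsCompetitive

end FourPartite

section Eight

variable {V ι : Type*}

/-- The out-neighbors of `u` are `x`, `y`, `z`, and theirs lie, besides among themselves, in
`{a, b, c}`; the arcs `y → c → b → y`, `z → a → c → z` and `x → b → a → x` of the out-triangles make
`x`, `y`, `z`, `a`, `b`, `c` pairwise adjacent. -/
structure IsTriangleSystem (D : Digraph V) (u x y z a b c : V) : Prop where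
  center : IsOutTriangle D u x y z
  left : IsOutTriangle D x y c b
  middle : IsOutTriangle D y z a c
  right : IsOutTriangle D z x b a

theorem IsTriangleSystem.rotate {D : Digraph V} {u x y z a b c : V}
    (S : IsTriangleSystem D u x y z a b c) : IsTriangleSystem D u y z x b c a where
  center := S.center.rotate
  left := S.middle
  middle := S.right
  right := S.left

theorem IsTriangleSystem.pairwise_adj {D : Digraph V} {u x y z a b c : V}
    (S : IsTriangleSystem D u x y z a b c) :
    [x, y, z, a, b, c].Pairwise fun v w => D.Adj v w ∨ D.Adj w v := by
  simp only [List.pairwise_cons, List.forall_mem_cons, List.not_mem_nil, false_implies,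
    implies_true, and_true, List.Pairwise.nil]
  simp only [S.left.adj, S.left.rotate.adj, S.left.rotate.rotate.adj, S.left.xy, S.left.yz,
    S.left.zx, S.middle.adj, S.middle.rotate.adj, S.middle.xy, S.middle.yz, S.middle.zx,
    S.right.adj, S.right.rotate.adj, S.right.yz, S.right.zx, true_or, or_true, and_self]

namespace IsCompetitive

variable {D : Digraph V} {p : V → ι} {u x y z a b c : V}

theorem length_le_card_of_pairwise_adj [Fintype ι] (h : IsCompetitive D p) {l : List V}
    (hl : l.Pairwise fun v w => D.Adj v w ∨ D.Adj w v) : l.length ≤ Fintype.card ι := by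
  have hnodup : (l.map p).Nodup :=
    List.pairwise_map.2 (hl.imp fun {v w} hvw => (h.adj_or_adj_iff v w).1 hvw)
  simpa using hnodup.length_le_card


theorem exists_isTriangleSystem [Fintype V] (h : IsCompetitive D p)
    (T : IsOutTriangle D u x y z) (hdeg : ∀ v, D.Adj u v → outdeg D v = 3) :
    ∃ a b c, IsTriangleSystem D u x y z a b c := by
  obtain ⟨a, hax, hya, hza⟩ := h.exists_adj_of_isOutTriangle T
  obtain ⟨b, hby, hzb, hxb⟩ := h.exists_adj_of_isOutTriangle T.rotate
  obtain ⟨c, hcz, hxc, hyc⟩ := h.exists_adj_of_isOutTriangle T.rotate.rotate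
  have outTriangle {x y b c : V} (hux : D.Adj u x) (hxy : D.Adj x y) (hxc : D.Adj x c)
      (hyc : D.Adj y c) (hxb : D.Adj x b) (hby : D.Adj b y) : IsOutTriangle D x y c b := by
    obtain ⟨s, t, T⟩ := h.exists_isOutTriangle (hdeg x hux) hxy
    obtain rfl := h.eq_of_isOutTriangle T hxc hyc
    obtain rfl | rfl | rfl := (T.adj_iff b).1 hxb
    · exact absurd rfl (h.ne hby)
    · exact absurd hyc (h.asymm _ _ hby)
    · exact T
  exact ⟨a, b, c, T, outTriangle T.adj T.xy hxc hyc hxb hby,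
    outTriangle T.rotate.adj T.yz hya hza hyc hcz,
    outTriangle T.rotate.rotate.adj T.zx hzb hxb hza hax⟩

theorem part_eq_of_isTriangleSystem [Fintype ι] (h : IsCompetitive D p)
    (hι : Fintype.card ι ≤ 6) (S : IsTriangleSystem D u x y z a b c) :
    p u = p a ∨ p u = p b ∨ p u = p c := by
  by_contra! hne
  have adj {v : V} (hv : p u ≠ p v) : D.Adj u v ∨ D.Adj v u := (h.adj_or_adj_iff u v).2 hv
  have hl : [u, x, y, z, a, b, c].Pairwise fun v w => D.Adj v w ∨ D.Adj w v :=
    S.pairwise_adj.cons <| by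
      simp [S.center.adj, S.center.rotate.adj, S.center.rotate.rotate.adj, adj, hne]
  have := h.length_le_card_of_pairwise_adj hl
  simp only [List.length_cons, List.length_nil] at this
  lia

theorem exists_adj_of_isTriangleSystem [Fintype V] (h : IsCompetitive D p)
    (hV : Fintype.card V ≤ 8) (S : IsTriangleSystem D u x y z a b c) (hua : p u = p a) :
    ∃ t, D.Adj a t ∧ D.Adj b t ∧ D.Adj c t := by
  obtain ⟨t, hat, hbt⟩ := h.exists_common a b (h.ne S.right.yz).symm
  obtain ⟨s, has, hcs⟩ := h.exists_common a c (h.ne S.middle.yz)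
  obtain rfl : s = t := by
    by_contra hst
    have hnodup : [x, y, z, a, b, c].Nodup :=
      S.pairwise_adj.imp fun hvw => ne_of_apply_ne p ((h.adj_or_adj_iff _ _).1 hvw)
    have hu : u ∉ [x, y, z, a, b, c] := by
      simp [h.ne S.center.adj, h.ne S.center.rotate.adj, h.ne S.center.rotate.rotate.adj,
        h.ne_of_adj_of_adj S.center.rotate.adj S.middle.rotate.adj,
        h.ne_of_adj_of_adj S.center.adj S.left.rotate.rotate.adj,
        h.ne_of_adj_of_adj S.center.adj S.left.rotate.adj]
    have notMem {v : V} (hav : D.Adj a v) (hvx : v ≠ x) (hvc : v ≠ c) :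
        v ∉ [u, x, y, z, a, b, c] := by
      have hvu : v ≠ u := fun hvu => h.part_ne hav (hvu ▸ hua.symm)
      have hvy : v ≠ y := (h.ne_of_adj_of_adj S.middle.rotate.adj hav).symm
      have hvz : v ≠ z := (h.ne_of_adj_of_adj S.middle.xy hav).symm
      have hvb : v ≠ b := (h.ne_of_adj_of_adj S.right.yz hav).symm
      simp [hvu, hvx, hvy, hvz, (h.ne hav).symm, hvb, hvc]
    have ht : t ∉ [u, x, y, z, a, b, c] :=
      notMem hat (h.ne_of_adj_of_adj S.left.rotate.rotate.adj hbt).symm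
        (h.ne_of_adj_of_adj S.left.yz hbt).symm
    have hs : s ∉ [t, u, x, y, z, a, b, c] :=
      List.not_mem_cons_of_ne_of_not_mem hst <|
        notMem has (h.ne_of_adj_of_adj S.left.rotate.adj hcs).symm (h.ne hcs).symm
    simpa using (((hnodup.cons hu).cons ht).cons hs).length_le_card.trans hV
  exact ⟨s, has, hbt, hcs⟩

theorem false_of_isTriangleSystem [Fintype ι] (h : IsCompetitive D p) (hι : Fintype.card ι ≤ 6)
    (S : IsTriangleSystem D u x y z a b c) {t : V} (hat : D.Adj a t) (hbt : D.Adj b t)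
    (hct : D.Adj c t) : False := by
  have adj {x y b c : V} (T : IsOutTriangle D x y c b) (hbt : D.Adj b t) (hct : D.Adj c t) :
      D.Adj t y := by
    obtain ⟨w, hxw, htw⟩ := h.exists_common x t (h.ne_of_adj_of_adj T.rotate.adj hct)
    obtain rfl | rfl | rfl := (T.adj_iff w).1 hxw
    · exact htw
    · exact absurd htw (h.asymm _ _ hct)
    · exact absurd htw (h.asymm _ _ hbt)
  have hl : [t, x, y, z, a, b, c].Pairwise fun v w => D.Adj v w ∨ D.Adj w v :=
    S.pairwise_adj.cons <| by
      simp [adj S.left hbt hct, adj S.middle hct hat, adj S.right hat hbt, hat, hbt, hct]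
  have := h.length_le_card_of_pairwise_adj hl
  simp only [List.length_cons, List.length_nil] at this
  lia

theorem exists_adj_outdeg_ne_three [Fintype V] [Fintype ι] [Nontrivial ι]
    (h : IsCompetitive D p) (hV : Fintype.card V ≤ 8) (hι : Fintype.card ι ≤ 6) (u : V)
    (hu : outdeg D u = 3) : ∃ v, D.Adj u v ∧ outdeg D v ≠ 3 := by
  by_contra! hdeg
  have not_part_eq {x y z a b c : V} (S : IsTriangleSystem D u x y z a b c) : p u ≠ p a := by
    intro hua
    obtain ⟨t, hat, hbt, hct⟩ := h.exists_adj_of_isTriangleSystem hV S hua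
    exact h.false_of_isTriangleSystem hι S hat hbt hct
  obtain ⟨x, y, z, T⟩ := h.exists_isOutTriangle_of_outdeg_eq_three hu
  obtain ⟨a, b, c, S⟩ := h.exists_isTriangleSystem T hdeg
  obtain hua | hub | huc := h.part_eq_of_isTriangleSystem hι S
  · exact not_part_eq S hua
  · exact not_part_eq S.rotate hub
  · exact not_part_eq S.rotate.rotate huc

theorem exists_not_adj_eq_pair [DecidableEq V] (h : IsCompetitive D p) {B : Finset V}
    (hB : B.Nonempty) (hcard : #B ≤ 2) : ∃ q r, ¬ D.Adj q r ∧ B = {q, r} := by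
  obtain hone | htwo : #B = 1 ∨ #B = 2 := by
    have := hB.card_pos
    lia
  · obtain ⟨q, rfl⟩ := card_eq_one.1 hone
    exact ⟨q, q, fun hqq => h.ne hqq rfl, (pair_eq_singleton q).symm⟩
  · obtain ⟨q, r, -, rfl⟩ := card_eq_two.1 htwo
    by_cases hqr : D.Adj q r
    · exact ⟨r, q, h.asymm _ _ hqr, pair_comm q r⟩
    · exact ⟨q, r, hqr, rfl⟩

/-- Otherwise the vertices of out-degree other than three are `q` and `r` with `q` not dominating
`r`. Every out-neighbor of `q` then dominates `r`, so `r` has at least four in-neighbors and at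
least four out-neighbors. -/
theorem two_lt_card_outdeg_ne_three [Fintype V] [Nontrivial ι] (h : IsCompetitive D p)
    (hV : Fintype.card V ≤ 8) (hdom : ∀ u, outdeg D u = 3 → ∃ v, D.Adj u v ∧ outdeg D v ≠ 3) :
    2 < #{v | outdeg D v ≠ 3} := by
  classical
  by_contra! hle
  obtain ⟨i⟩ : Nonempty ι := inferInstance
  obtain ⟨u, -⟩ := h.surjective i
  have hne : ({v | outdeg D v ≠ 3} : Finset V).Nonempty := by
    by_cases hu : outdeg D u = 3
    · exact (hdom u hu).imp fun v hv => mem_filter_univ v |>.2 hv.2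
    · exact ⟨u, mem_filter_univ u |>.2 hu⟩
  obtain ⟨q, r, hqr, hB⟩ := h.exists_not_adj_eq_pair hne hle
  have mem_B (v : V) : outdeg D v ≠ 3 ↔ v = q ∨ v = r := by simpa using Finset.ext_iff.1 hB v
  have hsub : outNeighbors D univ q ⊆ inNeighbors D univ r := by
    intro v hv
    have hqv : D.Adj q v := (mem_outNeighbors.1 hv).2
    obtain ⟨w, hvw, hw⟩ := hdom v (by grind [h.ne hqv])
    obtain rfl | rfl := (mem_B w).1 hw
    · exact absurd hvw (h.asymm _ _ hqv)
    · exact mem_inNeighbors.2 ⟨mem_univ v, hvw⟩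
  have hin : outdeg D q ≤ #(inNeighbors D univ r) := card_le_card hsub
  have hq : outdeg D q ≠ 3 := (mem_B q).2 (Or.inl rfl)
  have hr : outdeg D r ≠ 3 := (mem_B r).2 (Or.inr rfl)
  have hq3 := h.three_le_outdeg q
  have hr3 := h.three_le_outdeg r
  have hcard := h.card_outNeighbors_add_card_inNeighbors univ r
  have hpos := h.card_partiteSet_pos (p r)
  rw [univ_inter, card_univ, ← outdeg] at hcard
  lia

theorem card_ne_eight [Fintype V] [Fintype ι] [Nontrivial ι] (h : IsCompetitive D p)
    (hι : Fintype.card ι ≤ 6) : Fintype.card V ≠ 8 := by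
  intro hV
  obtain ⟨i⟩ : Nonempty ι := inferInstance
  have hdom := h.exists_adj_outdeg_ne_three hV.le hι
  have hB := h.two_lt_card_outdeg_ne_three hV.le hdom
  have hdeg := h.three_mul_card_add_le_sum_outdeg
  have hsq := card_partiteSet_sub_one_mul_sub_two_le p i
  have harcs := h.two_mul_sum_outdeg_add
  rw [hV] at hdeg hsq harcs
  zify at *
  -- With `s = #(partiteSet p i)` these bounds combine to `(2 * s - 3) ^ 2 + 7 ≤ 0`.
  nlinarith [sq_nonneg (2 * (#(partiteSet p i) : ℤ) - 3)]

end IsCompetitive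

end Eight

section Twelve

section FinsetCard

variable {α : Type*} [DecidableEq α] {S X X' Y Y' : Finset α}

theorem card_inter_symmDiff_add (Y X X' : Finset α) :
    #(Y ∩ symmDiff X X') + 2 * #(Y ∩ X ∩ X') = #(Y ∩ X) + #(Y ∩ X') := by
  have hunion : Y ∩ symmDiff X X' = (Y ∩ X) \ X' ∪ (Y ∩ X') \ X := by
    ext
    grind [mem_symmDiff]
  have hdisj : Disjoint ((Y ∩ X) \ X') ((Y ∩ X') \ X) := by
    rw [Finset.disjoint_left]
    grind
  rw [hunion, card_union_of_disjoint hdisj, ← card_sdiff_add_card_inter (Y ∩ X) X',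
    ← card_sdiff_add_card_inter (Y ∩ X') X, inter_right_comm Y X' X]
  ring

/-- By parity, `Y` contains both or neither of the two elements of `symmDiff X X'`. -/
theorem eq_symmDiff_or_eq_sdiff (hS : #S = 4) (hX : #X = 2) (hX' : #X' = 2) (hXS : X ⊆ S)
    (hXS' : X' ⊆ S) (hinter : ¬ Disjoint X X') (hne : X ≠ X') (hY : #Y = 2) (hYS : Y ⊆ S)
    (hYX : #(Y ∩ X) = 1) (hYX' : #(Y ∩ X') = 1) :
    Y = symmDiff X X' ∨ Y = S \ symmDiff X X' := by
  have hpos : 0 < #(X ∩ X') := card_pos.2 (not_disjoint_iff_nonempty_inter.1 hinter)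
  have hlt : #(X ∩ X') < 2 := by
    by_contra! hle
    have hXX' : X ∩ X' = X := eq_of_subset_of_card_le inter_subset_left (hX.trans_le hle)
    exact hne (eq_of_subset_of_card_le (inter_eq_left.1 hXX') (hX'.trans hX.symm).le)
  have hsub : symmDiff X X' ⊆ S := by grind [mem_symmDiff]
  have hcard := card_inter_symmDiff_add S X X'
  rw [inter_eq_right.2 hsub, inter_eq_right.2 hXS, inter_eq_right.2 hXS'] at hcard
  have hcardY := card_inter_symmDiff_add Y X X'
  obtain hzero | htwo : #(Y ∩ symmDiff X X') = 0 ∨ #(Y ∩ symmDiff X X') = 2 := by lia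
  · have hdisj : Disjoint Y (symmDiff X X') := disjoint_iff_inter_eq_empty.2 (card_eq_zero.1 hzero)
    refine Or.inr (eq_of_subset_of_card_le (subset_sdiff.2 ⟨hYS, hdisj⟩) ?_)
    rw [card_sdiff_of_subset hsub]
    lia
  · have hle : #Y ≤ #(Y ∩ symmDiff X X') := by lia
    have hYsub := inter_eq_left.1 (eq_of_subset_of_card_le inter_subset_left hle)
    exact Or.inl (eq_of_subset_of_card_le hYsub (by lia))

end FinsetCard

variable {V ι : Type*} [Fintype V] {D : Digraph V}

/-- The out-neighborhoods in the partite set `j` of the vertices of the partite set `i` are pairwise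
equal or disjoint. -/
def IsBlock (D : Digraph V) (p : V → ι) (i j : ι) : Prop :=
  ∀ ⦃u v⦄, p u = i → p v = i →
    Disjoint (outNeighbors D (partiteSet p j) u) (outNeighbors D (partiteSet p j) v) ∨
      outNeighbors D (partiteSet p j) u = outNeighbors D (partiteSet p j) v

namespace IsCompetitive

theorem card_outNeighbors_partiteSet_add {p : V → ι} (h : IsCompetitive D p) {j : ι} {u : V}
    (hu : p u ≠ j) :
    #(outNeighbors D (partiteSet p j) u) + #(inNeighbors D (partiteSet p j) u) =
      #(partiteSet p j) := by
  classical
  have hdisj : partiteSet p j ∩ partiteSet p (p u) = ∅ := by grind [mem_partiteSet]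
  simpa [hdisj] using h.card_outNeighbors_add_card_inNeighbors (partiteSet p j) u

theorem sum_card_outNeighbors_partiteSet_add {p : V → ι} (h : IsCompetitive D p) {i j : ι}
    (hij : i ≠ j) :
    ∑ u ∈ partiteSet p i, #(outNeighbors D (partiteSet p j) u) +
        ∑ v ∈ partiteSet p j, #(outNeighbors D (partiteSet p i) v) =
      #(partiteSet p i) * #(partiteSet p j) := by
  rw [sum_card_outNeighbors D (partiteSet p j), ← sum_add_distrib, ← smul_eq_mul, ← sum_const]
  refine sum_congr rfl fun u hu => h.card_outNeighbors_partiteSet_add ?_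
  rwa [mem_partiteSet.1 hu]

variable {p : V → Fin 3} {i j k : Fin 3} {u v : V}

theorem two_le_card_outNeighbors (h : IsCompetitive D p) (hu : p u ≠ j) :
    2 ≤ #(outNeighbors D (partiteSet p j) u) := by
  obtain ⟨x, hx⟩ := h.exists_adj u
  obtain ⟨y, hy, hpy⟩ : ∃ y, D.Adj u y ∧ p y = j := by
    obtain ⟨y, hy, hxy⟩ := h.exists_common u x (h.ne hx)
    by_cases hpx : p x = j
    · exact ⟨x, hx, hpx⟩
    · have := h.part_ne hx
      have := h.part_ne hy
      have := h.part_ne hxy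
      exact ⟨y, hy, by lia⟩
  obtain ⟨z, w, hz, hw, hyz, hzw⟩ := h.exists_adj_path hy
  have hpw : p w = j := by
    have := h.part_ne hz
    have := h.part_ne hw
    have := h.part_ne hyz
    have := h.part_ne hzw
    lia
  exact Finset.one_lt_card.2
    ⟨y, by simp [hy, hpy], w, by simp [hw, hpw], h.ne_of_adj_of_adj hyz hzw⟩

theorem two_mul_add_le_card_partiteSet_mul (h : IsCompetitive D p) (hij : i ≠ j) :
    2 * (#(partiteSet p i) + #(partiteSet p j)) ≤ #(partiteSet p i) * #(partiteSet p j) := by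
  have le_sum {i j : Fin 3} (hij : i ≠ j) :
      #(partiteSet p i) * 2 ≤ ∑ u ∈ partiteSet p i, #(outNeighbors D (partiteSet p j) u) :=
    card_nsmul_le_sum _ _ _ fun u hu =>
      h.two_le_card_outNeighbors (by rwa [mem_partiteSet.1 hu])
  have hsum := h.sum_card_outNeighbors_partiteSet_add hij
  have hi := le_sum hij
  have hj := le_sum hij.symm
  lia

theorem card_partiteSet_eq_four (h : IsCompetitive D p) (hV : Fintype.card V = 12) (i : Fin 3) :
    #(partiteSet p i) = 4 := by
  have h01 := h.two_mul_add_le_card_partiteSet_mul (i := 0) (j := 1) (by decide)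
  have h02 := h.two_mul_add_le_card_partiteSet_mul (i := 0) (j := 2) (by decide)
  have h12 := h.two_mul_add_le_card_partiteSet_mul (i := 1) (j := 2) (by decide)
  have hsum := sum_card_partiteSet p
  rw [hV, Fin.sum_univ_three] at hsum
  have hsq : (#(partiteSet p 0) + #(partiteSet p 1) + #(partiteSet p 2)) ^ 2 = 12 ^ 2 :=
    congrArg (· ^ 2) hsum
  have hle : ∑ i, ((#(partiteSet p i) : ℤ) - 4) ^ 2 ≤ 0 := by
    rw [Fin.sum_univ_three]
    zify at h01 h02 h12 hsum hsq
    -- `∑ (s - 4) ^ 2 = 96 - 2 * ∑ s * t`, and the three bounds add up to `48 ≤ ∑ s * t`.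
    linarith
  have hi : ((#(partiteSet p i) : ℤ) - 4) ^ 2 ≤ 0 :=
    (single_le_sum (f := fun i => ((#(partiteSet p i) : ℤ) - 4) ^ 2)
      (fun _ _ => sq_nonneg _) (mem_univ i)).trans hle
  have hzero := pow_eq_zero_iff two_ne_zero |>.1 (hi.antisymm (sq_nonneg _))
  lia

theorem card_outNeighbors_eq_two (h : IsCompetitive D p) (hV : Fintype.card V = 12)
    (hu : p u ≠ j) : #(outNeighbors D (partiteSet p j) u) = 2 := by
  have two_le {i j : Fin 3} (hij : i ≠ j) :
      ∀ v ∈ partiteSet p i, 2 ≤ #(outNeighbors D (partiteSet p j) v) :=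
    fun v hv => h.two_le_card_outNeighbors (by rwa [mem_partiteSet.1 hv])
  have hsum := h.sum_card_outNeighbors_partiteSet_add hu
  have hle := card_nsmul_le_sum _ _ _ (two_le hu.symm)
  have hle' := card_nsmul_le_sum _ _ _ (two_le hu)
  simp only [h.card_partiteSet_eq_four hV, smul_eq_mul] at hsum hle hle'
  have heq : ∑ v ∈ partiteSet p (p u), 2 =
      ∑ v ∈ partiteSet p (p u), #(outNeighbors D (partiteSet p j) v) := by
    rw [sum_const, h.card_partiteSet_eq_four hV, smul_eq_mul]
    lia
  exact ((sum_eq_sum_iff_of_le (two_le hu)).1 heq u (mem_partiteSet.2 rfl)).symm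

theorem card_inNeighbors_eq_two (h : IsCompetitive D p) (hV : Fintype.card V = 12)
    (hu : p u ≠ j) : #(inNeighbors D (partiteSet p j) u) = 2 := by
  have hadd := h.card_outNeighbors_partiteSet_add hu
  rw [h.card_outNeighbors_eq_two hV hu, h.card_partiteSet_eq_four hV] at hadd
  lia

theorem card_inter_outNeighbors_eq_one [DecidableEq V] (h : IsCompetitive D p)
    (hV : Fintype.card V = 12) (huv : p u ≠ p v) (hu : p u ≠ k) (hv : p v ≠ k) :
    #(outNeighbors D (partiteSet p k) u ∩ outNeighbors D (partiteSet p k) v) = 1 := by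
  have one_le : ∀ v' ∈ partiteSet p (p v), 1 ≤ #(outNeighbors D (partiteSet p k) u ∩
      outNeighbors D (partiteSet p k) v') := by
    intro v' hv'
    rw [mem_partiteSet] at hv'
    obtain ⟨w, huw, hvw⟩ := h.exists_common u v' (ne_of_apply_ne p (hv' ▸ huv))
    have hpw : p w = k := by
      have := h.part_ne huw
      have := h.part_ne hvw
      lia
    exact card_pos.2 ⟨w, by simp [huw, hvw, hpw]⟩
  have heq : ∑ v' ∈ partiteSet p (p v), 1 = ∑ v' ∈ partiteSet p (p v),
      #(outNeighbors D (partiteSet p k) u ∩ outNeighbors D (partiteSet p k) v') := by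
    simp only [← outNeighbors_outNeighbors, sum_card_outNeighbors]
    rw [sum_congr rfl fun w hw => h.card_inNeighbors_eq_two hV
      ((mem_partiteSet.1 (mem_outNeighbors.1 hw).1).trans_ne hv.symm)]
    simp [h.card_partiteSet_eq_four hV, h.card_outNeighbors_eq_two hV hu]
  exact ((sum_eq_sum_iff_of_le one_le).1 heq v (mem_partiteSet.2 rfl)).symm

theorem isBlock_or_isBlock (h : IsCompetitive D p) (hV : Fintype.card V = 12) (hij : i ≠ j)
    (hik : i ≠ k) (hjk : j ≠ k) : IsBlock D p i k ∨ IsBlock D p j k := by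
  classical
  refine or_iff_not_imp_left.2 fun hblock => ?_
  simp only [IsBlock, not_forall, not_or] at hblock
  obtain ⟨u, u', rfl, hu', hinter, hne⟩ := hblock
  have eq_or_eq {v : V} (hv : p v = j) := eq_symmDiff_or_eq_sdiff
    (h.card_partiteSet_eq_four hV k) (h.card_outNeighbors_eq_two hV hik)
    (h.card_outNeighbors_eq_two hV (hu'.trans_ne hik))
    (filter_subset _ _) (filter_subset _ _) hinter hne
    (h.card_outNeighbors_eq_two hV (hv.trans_ne hjk)) (filter_subset _ _)
    (h.card_inter_outNeighbors_eq_one hV (by lia) (by lia) hik)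
    (h.card_inter_outNeighbors_eq_one hV (by lia) (by lia) (by lia))
  intro v v' hv hv'
  obtain hY | hY := eq_or_eq hv <;> obtain hY' | hY' := eq_or_eq hv'
  · exact Or.inr (hY.trans hY'.symm)
  · exact Or.inl (hY ▸ hY' ▸ disjoint_sdiff)
  · exact Or.inl (hY ▸ hY' ▸ sdiff_disjoint)
  · exact Or.inr (hY.trans hY'.symm)

theorem isBlock_symm (h : IsCompetitive D p) (hV : Fintype.card V = 12) (hij : i ≠ j)
    (hblock : IsBlock D p i j) : IsBlock D p j i := by
  classical
  rintro v v' rfl hv'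
  by_contra! hne
  obtain ⟨hinter, hne⟩ := hne
  obtain ⟨u, hvu, hvu'⟩ := Finset.not_disjoint_iff.1 hinter
  obtain ⟨t, hvt, hvt'⟩ := Finset.not_subset.1 fun hsub => hne <| eq_of_subset_of_card_le hsub <| by
    rw [h.card_outNeighbors_eq_two hV hij.symm, h.card_outNeighbors_eq_two hV (by lia)]
  simp only [mem_outNeighbors, mem_partiteSet] at hvu hvu' hvt hvt'
  have htv' : D.Adj t v' := by
    have := h.adj_or_adj_iff t v'
    grind
  obtain hdisj | heq := hblock hvu.1 hvt.1
  · have hsub : outNeighbors D (partiteSet p (p v)) u ∪ outNeighbors D (partiteSet p (p v)) t ⊆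
        (partiteSet p (p v)).erase v := by
      have huv := h.asymm v u hvu.2
      have htv := h.asymm v t hvt.2
      grind [mem_outNeighbors]
    have hcard := card_le_card hsub
    rw [card_union_of_disjoint hdisj, h.card_outNeighbors_eq_two hV (by lia),
      h.card_outNeighbors_eq_two hV (by lia), card_erase_of_mem (mem_partiteSet.2 rfl),
      h.card_partiteSet_eq_four hV] at hcard
    lia
  · have huv' : v' ∈ outNeighbors D (partiteSet p (p v)) u := by simp [heq, htv', hv']
    exact h.asymm _ _ hvu'.2 (mem_outNeighbors.1 huv').2

/-- Two partitions of a partite set into pairs leave a vertex outside both pairs of `u`, and that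
vertex has no common out-neighbor with `u`. -/
theorem not_isBlock_of_isBlock (h : IsCompetitive D p) (hV : Fintype.card V = 12) (hij : i ≠ j)
    (hik : i ≠ k) (hjk : j ≠ k) (hblock : IsBlock D p i j) : ¬ IsBlock D p i k := by
  classical
  intro hblock'
  obtain ⟨u, rfl⟩ := h.surjective i
  have exists_outNeighbor {j : Fin 3} (hj : p u ≠ j) : ∃ w, D.Adj u w ∧ p w = j := by
    have hcard := h.card_outNeighbors_eq_two hV hj
    obtain ⟨w, hw⟩ := card_pos.1 (hcard ▸ two_pos)
    exact ⟨w, (mem_outNeighbors.1 hw).2, mem_partiteSet.1 (mem_outNeighbors.1 hw).1⟩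
  have adj_of_isBlock {v w w' : V} (hb : IsBlock D p (p u) (p w)) (hv : p v = p u)
      (huw : D.Adj u w) (hw' : p w' = p w) (huw' : D.Adj u w') (hvw' : D.Adj v w') :
      D.Adj v w := by
    obtain hdisj | heq := hb rfl hv
    · exact absurd (Finset.not_disjoint_iff.2 ⟨w', by simp [*], by simp [*]⟩) (not_not.2 hdisj)
    · exact (mem_outNeighbors.1 (heq ▸ mem_outNeighbors.2 ⟨mem_partiteSet.2 rfl, huw⟩)).2
  obtain ⟨w, huw, rfl⟩ := exists_outNeighbor hij
  obtain ⟨t, hut, rfl⟩ := exists_outNeighbor hik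
  set A := inNeighbors D (partiteSet p (p u)) w
  set B := inNeighbors D (partiteSet p (p u)) t
  have hcover : partiteSet p (p u) ⊆ A ∪ B := by
    intro v hv
    have hpv : p v = p u := mem_partiteSet.1 hv
    obtain rfl | hvu := eq_or_ne v u
    · exact mem_union_left _ (mem_inNeighbors.2 ⟨hv, huw⟩)
    obtain ⟨w', hvw', huw'⟩ := h.exists_common v u hvu
    obtain hw' | hw' : p w' = p w ∨ p w' = p t := by
      have := h.part_ne huw'
      lia
    · exact mem_union_left _
        (mem_inNeighbors.2 ⟨hv, adj_of_isBlock hblock hpv huw hw' huw' hvw'⟩)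
    · exact mem_union_right _
        (mem_inNeighbors.2 ⟨hv, adj_of_isBlock hblock' hpv hut hw' huw' hvw'⟩)
  have hA : #A = 2 := h.card_inNeighbors_eq_two hV hij.symm
  have hB : #B = 2 := h.card_inNeighbors_eq_two hV hik.symm
  have hAB : 0 < #(A ∩ B) := card_pos.2 ⟨u, by simp [A, B, huw, hut]⟩
  have hcard := card_le_card hcover
  rw [h.card_partiteSet_eq_four hV] at hcard
  have := card_union_add_card_inter A B
  lia

theorem card_ne_twelve (h : IsCompetitive D p) : Fintype.card V ≠ 12 := by
  intro hV
  have block_or {i j k : Fin 3} := h.isBlock_or_isBlock hV (i := i) (j := j) (k := k)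
  have block_symm {i j : Fin 3} := h.isBlock_symm hV (i := i) (j := j)
  have not_block {i j k : Fin 3} := h.not_isBlock_of_isBlock hV (i := i) (j := j) (k := k)
  have h02 : IsBlock D p 0 2 ∨ IsBlock D p 1 2 := block_or (by decide) (by decide) (by decide)
  have h01 : IsBlock D p 0 1 ∨ IsBlock D p 2 1 := block_or (by decide) (by decide) (by decide)
  have h10 : IsBlock D p 1 0 ∨ IsBlock D p 2 0 := block_or (by decide) (by decide) (by decide)
  grind

end IsCompetitive

end Twelve

theorem not_isRealizable_three_twelve : ¬ IsRealizable 3 (Fin 12) := fun ⟨_, _, h⟩ =>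
  h.card_ne_twelve (Fintype.card_fin 12)

theorem not_isRealizable_four_nine : ¬ IsRealizable 4 (Fin 9) := fun ⟨_, _, h⟩ =>
  h.card_ne_nine (Fintype.card_fin 9)

theorem not_isRealizable_eight {k : ℕ} (hk : 2 ≤ k) (hk' : k ≤ 6) : ¬ IsRealizable k (Fin 8) :=
  fun ⟨_, _, h⟩ =>
    have : Nontrivial (Fin k) := Fin.nontrivial_iff_two_le.2 hk
    h.card_ne_eight (by simpa) (Fintype.card_fin 8)

theorem isRealizable_iff_le_card {V : Type*} {k m : ℕ} (hk : 2 ≤ k)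
    (hm : ¬ IsRealizable k (Fin m)) (hm' : IsRealizable k (Fin (m + 1))) :
    IsRealizable k V ↔ ((m + 1 : ℕ) : ℕ∞) ≤ ENat.card V :=
  ⟨IsRealizable.succ_le_card hk hm, IsRealizable.of_le_card hk hm'⟩

theorem mainTheorem5_general {V : Type*} (k : ℕ) (hk : 3 ≤ k) :
    (∃ D : Digraph V, IsPartiteTournament k D ∧
        competitionGraph D = SimpleGraph.completeGraph V) ↔
      ((k = 3 ∧ 13 ≤ ENat.card V) ∨ (k = 4 ∧ 10 ≤ ENat.card V) ∨ (k = 5 ∧ 9 ≤ ENat.card V) ∨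
        (k = 6 ∧ 9 ≤ ENat.card V) ∨ (7 ≤ k ∧ k ≤ ENat.card V)) := by
  rw [exists_isPartiteTournament_iff_isRealizable]
  obtain rfl | rfl | rfl | rfl | hk7 : k = 3 ∨ k = 4 ∨ k = 5 ∨ k = 6 ∨ 7 ≤ k := by lia
  · simpa using isRealizable_iff_le_card (by decide)
      not_isRealizable_three_twelve isRealizable_three_thirteen
  · simpa using isRealizable_iff_le_card (by decide)
      not_isRealizable_four_nine isRealizable_four_ten
  · simpa using isRealizable_iff_le_card (by decide)
      (not_isRealizable_eight (by decide) (by decide)) isRealizable_five_nine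
  · simpa using isRealizable_iff_le_card (by decide)
      (not_isRealizable_eight (by decide) (by decide)) isRealizable_six_nine
  · rw [show IsRealizable k V ↔ k ≤ ENat.card V from
      ⟨IsRealizable.le_card, IsRealizable.of_le_card (by lia) (isRealizable_self hk7)⟩]
    have : k ≠ 3 ∧ k ≠ 4 ∧ k ≠ 5 ∧ k ≠ 6 := by lia
    simp [*]

theorem mainTheorem5 (k : ℕ) (hk : 3 ≤ k) (n : ℕ) :
    (∃ D : Digraph (Fin n), IsPartiteTournament k D ∧
        competitionGraph D = SimpleGraph.completeGraph (Fin n)) ↔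
      ((k = 3 ∧ 13 ≤ n) ∨ (k = 4 ∧ 10 ≤ n) ∨ (k = 5 ∧ 9 ≤ n) ∨ (k = 6 ∧ 9 ≤ n) ∨
        (7 ≤ k ∧ k ≤ n)) := by
  rw [mainTheorem5_general k hk, ENat.card_eq_coe_fintype_card, Fintype.card_fin]
  norm_cast
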